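/- For non-negative integers $n,k,d$ let $f(n,k,d)$ be the maximum, over all families $\mathcal F$ of at most $k$ subsets of $[n]=\{1,\dots,n\}$, of the number of $d$-element sets $A\subseteq[n]$ that $\mathcal F$ shatters, where $\mathcal F$ shatters $A$ if for every $A'\subseteq A$ there is an $F\in\mathcal F$ with $F\cap A=A'$. For $d\ge 1$ let $$c_d=\frac{(2^d-2)(2^d-4)\cdots(2^d-2^{d-1})}{(2^d-1)^{d-1}}.$$ **Theorem 1.3.** The infinite product $c=\prod_{i=1}^{\infty}(1-2^{-i})$ converges, $c=\lim_{d\to\infty}c_d$, $c$ is also the limit as $m\to\infty$ of the probability that a uniformly random $m\times m$ matrix over $\mathbb F_2$ is invertible, and $c\approx 0.289$ (correct to three decimals: $|c-0.289|<0.0005$). If $n,k,d$ are positive integers varying so that $d\to\infty$, $n-d\to\infty$, $k\ge 2^d$ and $k=(1+o(1))2^d$, then $$f(n,k,d)=(1+o(1))\,c\binom{n}{d}.$$ In particular, if $d\to\infty$ and $n-d\to\infty$, then $f(n,2^d,d)=(1+o(1))\,c\binom{n}{d}$. -/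

import Mathlib

open Filter Topology Asymptotics

noncomputable section

/-- The number of subsets of `[n]` of size `d` that are shattered by the family `F`.
Here `F.Shatters A` means that every `A' ⊆ A` is of the form `A ∩ B` with `B ∈ F`. -/
def numShattered (n d : ℕ) (F : Finset (Finset (Fin n))) : ℕ :=
  (((Finset.univ : Finset (Fin n)).powersetCard d).filter (fun A => F.Shatters A)).card

/-- `f(n, k, d)`: the largest number of subsets of `[n]` of size `d` that a family of at most `k`
subsets of `[n]` can shatter. The families compared are finitely many and include the empty one. -/
def maxShattered (n k d : ℕ) : ℕ :=
  ((Finset.univ : Finset (Finset (Finset (Fin n)))).filter (fun F => F.card ≤ k)).sup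
    (numShattered n d)

/-- `c_d = (2^d - 2)(2^d - 4) ⋯ (2^d - 2^(d-1)) / (2^d - 1)^(d-1)` for `d ≥ 1`. -/
def shatterConst (d : ℕ) : ℝ :=
  (∏ i ∈ Finset.Ico 1 d, ((2 : ℝ) ^ d - 2 ^ i)) / ((2 : ℝ) ^ d - 1) ^ (d - 1)

/-- The probability that a uniformly random `m × m` matrix over `𝔽₂` is invertible. -/
def invertibleProb (m : ℕ) : ℝ :=
  (Nat.card {M : Matrix (Fin m) (Fin m) (ZMod 2) // IsUnit M} : ℝ) /
    (Nat.card (Matrix (Fin m) (Fin m) (ZMod 2)) : ℝ)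

/-- `c = ∏_{i ≥ 1} (1 - 2^(-i))`, indexed from `i = 0`. -/
def limitConst : ℝ :=
  ∏' i : ℕ, (1 - (2 : ℝ)⁻¹ ^ (i + 1))

end

/-!
The constant `c = limitConst` enters through its partial products: `partialConst d` is exactly the
probability that a `d × d` matrix over `𝔽₂` is invertible.

*Lower bound.* Label the points of `[n]` by independent random vectors of `𝔽₂ᵈ` and take the `2 ^ d`
sets cut out by the linear functionals (`linearFamily`). A `d`-set is shattered as soon as its labels
form a basis, so the expected proportion of shattered `d`-sets is at least `partialConst d`
(`partialConst_mul_choose_le_maxShattered`).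

*Upper bound, reduction to fixed size.* Fix `D`, and let `k < 2 ^ d + 2 ^ (d - D)`. For a
`(d - D)`-set `B`, some trace on `B` is shared by at most `2 ^ D` members of the family, and these
members shatter `A \ B` for every shattered `A ⊇ B` (`exists_trace_class`). Double counting pairs
`B ⊆ A` reduces the problem to families of `2 ^ D` sets on `n - d + D` points, where `D` is constant
and the number of points tends to infinity (`maxShattered_le`).

*Upper bound, fixed size.* A shattered `D`-set is then a `D`-tuple of columns of a matrix with
`2 ^ D` rows in which every pattern occurs exactly once, so that each of its initial segments is
balanced. Given a balanced `i`-tuple, whose patterns each occur `Q = 2 ^ (D - i)` times, a column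
extends it only if it is orthogonal, in `±1` notation, to the indicator of each pattern. Summing the
squared inner products over a random column gives a sum of correlations over the pairs of rows with
equal patterns. The diagonal pairs alone make the extension probability at most `1 - 1 / Q`, and
negative correlations do little harm: rows with correlation `-y` agree on `i` random columns with
probability `((1 - y) / 2) ^ i`, and `y (1 - y) ^ i ≤ 1 / i` (`balancedCount_succ_le`). Iterating over
the last `J` columns bounds the proportion of balanced `D`-tuples by
`∏_{j ≤ J} (1 - 2⁻ʲ) + J / (D - J)` (`balancedCount_le`). Letting `D → ∞` and then `J → ∞` gives `c`.
-/

/-! ### The constant `∏ (1 - 2⁻ⁱ)` -/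

/-- The partial products `∏_{i = 1}^{J} (1 - 2^(-i))` of `limitConst`. -/
noncomputable def partialConst (J : ℕ) : ℝ :=
  ∏ i ∈ Finset.range J, (1 - (2 : ℝ)⁻¹ ^ (i + 1))

lemma one_sub_half_pow_pos (i : ℕ) : 0 < 1 - (2 : ℝ)⁻¹ ^ (i + 1) :=
  sub_pos.2 (pow_lt_one₀ (by norm_num) (by norm_num) (Nat.succ_ne_zero i))

lemma one_sub_half_pow_le_one (i : ℕ) : 1 - (2 : ℝ)⁻¹ ^ (i + 1) ≤ 1 :=
  sub_le_self _ (by positivity)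

lemma partialConst_pos (J : ℕ) : 0 < partialConst J :=
  Finset.prod_pos fun i _ => one_sub_half_pow_pos i

lemma partialConst_succ (J : ℕ) :
    partialConst (J + 1) = partialConst J * (1 - (2 : ℝ)⁻¹ ^ (J + 1)) :=
  Finset.prod_range_succ _ _

lemma multipliable_one_sub_half_pow :
    Multipliable (fun i : ℕ => 1 - (2 : ℝ)⁻¹ ^ (i + 1)) := by
  have hs : Summable (fun i : ℕ => -((2 : ℝ)⁻¹ ^ (i + 1))) :=
    ((summable_nat_add_iff 1).2
      (summable_geometric_of_lt_one (r := (2 : ℝ)⁻¹) (by norm_num) (by norm_num))).neg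
  simpa only [← sub_eq_add_neg] using Real.multipliable_one_add_of_summable hs

lemma tendsto_partialConst : Tendsto partialConst atTop (𝓝 limitConst) :=
  multipliable_one_sub_half_pow.hasProd.tendsto_prod_nat

lemma limitConst_le_partialConst (J : ℕ) : limitConst ≤ partialConst J := by
  refine (antitone_nat_of_succ_le fun n => ?_).le_of_tendsto tendsto_partialConst J
  rw [partialConst_succ]
  exact mul_le_of_le_one_right (partialConst_pos n).le (one_sub_half_pow_le_one n)

lemma partialConst_add_ge (N t : ℕ) :
    partialConst N * (1 - (2 : ℝ)⁻¹ ^ N + 2⁻¹ ^ (N + t)) ≤ partialConst (N + t) := by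
  induction t with
  | zero => simp
  | succ t ih =>
    have hb : (0 : ℝ) < 2⁻¹ ^ (N + t) := by positivity
    have hab : (2 : ℝ)⁻¹ ^ (N + t) ≤ 2⁻¹ ^ N :=
      pow_le_pow_of_le_one (by norm_num) (by norm_num) (by lia)
    rw [← add_assoc, partialConst_succ]
    refine le_trans ?_ (mul_le_mul_of_nonneg_right ih (one_sub_half_pow_pos _).le)
    rw [mul_assoc, pow_succ]
    refine mul_le_mul_of_nonneg_left ?_ (partialConst_pos N).le
    nlinarith [mul_nonneg hb.le (sub_nonneg.2 hab)]

lemma partialConst_mul_le_limitConst (N : ℕ) :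
    partialConst N * (1 - (2 : ℝ)⁻¹ ^ N) ≤ limitConst := by
  refine ge_of_tendsto tendsto_partialConst ((eventually_ge_atTop N).mono fun M hM => ?_)
  obtain ⟨t, rfl⟩ := Nat.exists_eq_add_of_le hM
  refine le_trans ?_ (partialConst_add_ge N t)
  exact mul_le_mul_of_nonneg_left (le_add_of_nonneg_right (by positivity)) (partialConst_pos N).le

lemma limitConst_pos : 0 < limitConst :=
  lt_of_lt_of_le (mul_pos (partialConst_pos 1) (one_sub_half_pow_pos 0))
    (partialConst_mul_le_limitConst 1)

lemma abs_limitConst_sub_lt : |limitConst - 0.289| < 0.0005 := by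
  have h1 := limitConst_le_partialConst 12
  have h2 := partialConst_mul_le_limitConst 12
  norm_num [partialConst, Finset.prod_range_succ] at h1 h2
  rw [abs_lt]
  constructor <;> norm_num <;> linarith

/-- Pulling the factor `2 ^ d` out of each term of the numerator leaves a partial product of
`limitConst`, up to a correction that tends to `1`. -/
lemma shatterConst_succ (n : ℕ) :
    shatterConst (n + 1) = partialConst n / (1 - (2 : ℝ)⁻¹ ^ (n + 1)) ^ n := by
  have h2 : (2 : ℝ) ^ (n + 1) - 1 = 2 ^ (n + 1) * (1 - 2⁻¹ ^ (n + 1)) := by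
    rw [mul_sub, ← mul_pow]; norm_num
  have h3 : ∏ i ∈ Finset.Ico 1 (n + 1), ((2 : ℝ) ^ (n + 1) - 2 ^ i)
      = (2 ^ (n + 1)) ^ n * partialConst n := by
    rw [Finset.prod_Ico_eq_prod_range, Nat.add_sub_cancel, ← Finset.prod_range_reflect,
      partialConst,
      show ((2 : ℝ) ^ (n + 1)) ^ n = ∏ _i ∈ Finset.range n, (2 : ℝ) ^ (n + 1) by simp,
      ← Finset.prod_mul_distrib]
    refine Finset.prod_congr rfl fun i hi => ?_
    have hi := Finset.mem_range.1 hi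
    have : n + 1 = (1 + (n - 1 - i)) + (i + 1) := by lia
    rw [mul_sub, mul_one]
    congr 1
    conv_rhs => rw [this, pow_add, mul_assoc, ← mul_pow]
    norm_num
  rw [shatterConst, h3, Nat.add_sub_cancel, h2, mul_pow, mul_div_mul_left _ _ (by positivity)]

lemma tendsto_one_sub_half_pow_pow :
    Tendsto (fun n : ℕ => (1 - (2 : ℝ)⁻¹ ^ (n + 1)) ^ n) atTop (𝓝 1) := by
  have h0 : Tendsto (fun n : ℕ => 1 + (n : ℝ) * -(2⁻¹ ^ (n + 1))) atTop (𝓝 1) := by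
    have := (tendsto_self_mul_const_pow_of_lt_one (r := (2 : ℝ)⁻¹) (by norm_num)
      (by norm_num)).mul_const (-(2 : ℝ)⁻¹)
    simpa [pow_succ, mul_assoc] using this.const_add 1
  refine tendsto_of_tendsto_of_tendsto_of_le_of_le h0 tendsto_const_nhds (fun n => ?_) fun n => ?_
  · have := one_add_mul_le_pow (a := -(2 : ℝ)⁻¹ ^ (n + 1))
      (by have := one_sub_half_pow_pos n; linarith) n
    simpa [sub_eq_add_neg] using this
  · exact pow_le_one₀ (one_sub_half_pow_pos n).le (one_sub_half_pow_le_one n)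

lemma tendsto_shatterConst : Tendsto shatterConst atTop (𝓝 limitConst) := by
  rw [← tendsto_add_atTop_iff_nat 1]
  simp only [shatterConst_succ]
  rw [← div_one limitConst]
  exact tendsto_partialConst.div tendsto_one_sub_half_pow_pow one_ne_zero

/-! ### Invertible matrices over `𝔽₂` -/

lemma card_isUnit_matrix (m : ℕ) :
    (Nat.card {M : Matrix (Fin m) (Fin m) (ZMod 2) // IsUnit M} : ℝ)
      = partialConst m * (2 ^ m) ^ m := by
  have h1 : Nat.card {M : Matrix (Fin m) (Fin m) (ZMod 2) // IsUnit M}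
      = Nat.card (GL (Fin m) (ZMod 2)) :=
    Nat.card_congr (Equiv.ofBijective (fun u => ⟨u.1, u.isUnit⟩)
      ⟨fun u v h => Units.ext (Subtype.ext_iff.1 h), fun M => ⟨M.2.unit, rfl⟩⟩).symm
  rw [h1, Matrix.card_GL_field, ZMod.card, Fin.prod_univ_eq_prod_range (fun i => 2 ^ m - 2 ^ i) m,
    Nat.cast_prod, partialConst, ← Finset.prod_range_reflect,
    show ((2 : ℝ) ^ m) ^ m = ∏ _i ∈ Finset.range m, (2 : ℝ) ^ m by simp,
    ← Finset.prod_mul_distrib]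
  refine Finset.prod_congr rfl fun i hi => ?_
  have hi := Finset.mem_range.1 hi
  have : m = (m - 1 - i) + (i + 1) := by lia
  rw [Nat.cast_sub (Nat.pow_le_pow_right (by norm_num) (by lia)), sub_mul, one_mul]
  push_cast
  congr 1
  conv_rhs => rhs; rw [this, pow_add, mul_comm]
  rw [← mul_assoc, ← mul_pow]
  norm_num

lemma invertibleProb_eq_partialConst (m : ℕ) : invertibleProb m = partialConst m := by
  have h : (Nat.card (Matrix (Fin m) (Fin m) (ZMod 2)) : ℝ) = (2 ^ m) ^ m := by
    simp [Matrix, Nat.card_eq_fintype_card]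
  rw [invertibleProb, card_isUnit_matrix, h, mul_div_cancel_right₀ _ (by positivity)]

lemma tendsto_invertibleProb : Tendsto invertibleProb atTop (𝓝 limitConst) := by
  simpa only [funext invertibleProb_eq_partialConst] using tendsto_partialConst

/-! ### Lower bound: families of linear functionals over `𝔽₂` -/

/-- Label each `x ∈ [n]` by a vector `v x ∈ 𝔽₂ᵈ`; every `u ∈ 𝔽₂ᵈ` contributes the set of those `x`
with `⟨v x, u⟩ = 1`. -/
def linearFamily {n d : ℕ} (v : Fin n → Fin d → ZMod 2) : Finset (Finset (Fin n)) :=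
  Finset.univ.image fun u : Fin d → ZMod 2 => Finset.univ.filter fun x => v x ⬝ᵥ u = 1

lemma card_linearFamily_le {n d : ℕ} (v : Fin n → Fin d → ZMod 2) :
    (linearFamily v).card ≤ 2 ^ d :=
  Finset.card_image_le.trans (by simp)

/-- A set whose labels form a basis is shattered: its traces are the solutions of a
nonsingular linear system. -/
lemma linearFamily_shatters {n d : ℕ} (v : Fin n → Fin d → ZMod 2) (A : Finset (Fin n))
    (e : Fin d ≃ A) (h : IsUnit (Matrix.of fun i => v (e i))) : (linearFamily v).Shatters A := by
  intro t ht
  set M : Matrix (Fin d) (Fin d) (ZMod 2) := Matrix.of fun i => v (e i) with hM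
  set b : Fin d → ZMod 2 := fun i => if (e i : Fin n) ∈ t then 1 else 0 with hb
  have hsol : M.mulVec (M⁻¹.mulVec b) = b := by
    rw [Matrix.mulVec_mulVec, Matrix.mul_nonsing_inv _ ((Matrix.isUnit_iff_isUnit_det M).1 h),
      Matrix.one_mulVec]
  refine ⟨_, Finset.mem_image_of_mem _ (Finset.mem_univ (M⁻¹.mulVec b)), ?_⟩
  ext x
  simp only [Finset.mem_inter, Finset.mem_filter, Finset.mem_univ, true_and]
  refine ⟨fun ⟨hxA, hx⟩ => ?_, fun hx => ⟨ht hx, ?_⟩⟩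
  · have h1 := congrFun hsol (e.symm ⟨x, hxA⟩)
    simp only [Matrix.mulVec, hM, Matrix.of_apply, Equiv.apply_symm_apply, hb] at h1
    by_contra hxt
    rw [if_neg hxt] at h1
    exact zero_ne_one (h1.symm.trans hx)
  · have h1 := congrFun hsol (e.symm ⟨x, ht hx⟩)
    simp only [Matrix.mulVec, hM, Matrix.of_apply, Equiv.apply_symm_apply, hb, if_pos hx] at h1
    exact h1

lemma card_labelings_shattering_ge {n d : ℕ} (A : Finset (Fin n)) (hA : A.card = d) :
    Nat.card {M : Matrix (Fin d) (Fin d) (ZMod 2) // IsUnit M} * (2 ^ d) ^ (n - d) ≤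
      (Finset.univ.filter fun v : Fin n → Fin d → ZMod 2 => (linearFamily v).Shatters A).card := by
  classical
  let e : Fin d ≃ A := (A.equivFinOfCardEq hA).symm
  let φ : {M : Matrix (Fin d) (Fin d) (ZMod 2) // IsUnit M} ×
      ({x : Fin n // x ∉ A} → Fin d → ZMod 2) → (Fin n → Fin d → ZMod 2) :=
    fun p x => if h : x ∈ A then p.1.1 (e.symm ⟨x, h⟩) else p.2 ⟨x, h⟩
  have hφA : ∀ p i, φ p (e i) = p.1.1 i := fun p i => by simp [φ]
  have hφ : Function.Injective φ := by
    intro p q hpq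
    refine Prod.ext (Subtype.ext (funext fun i => ?_)) (funext fun x => ?_)
    · rw [← hφA p, ← hφA q, hpq]
    · simpa [φ, x.2] using congrFun hpq x
  have hcard : Nat.card {M : Matrix (Fin d) (Fin d) (ZMod 2) // IsUnit M} * (2 ^ d) ^ (n - d)
      = (Finset.univ : Finset ({M : Matrix (Fin d) (Fin d) (ZMod 2) // IsUnit M} ×
        ({x : Fin n // x ∉ A} → Fin d → ZMod 2))).card := by
    rw [Finset.card_univ, Fintype.card_prod, Nat.card_eq_fintype_card]
    simp [Fintype.card_subtype_compl, hA]
  rw [hcard]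
  refine Finset.card_le_card_of_injOn φ (fun p _ => ?_) hφ.injOn
  simp only [Finset.coe_filter, Finset.mem_univ, true_and, Set.mem_ofPred_eq]
  refine linearFamily_shatters _ A e ?_
  convert p.1.2
  exact funext (hφA p)

lemma numShattered_le_maxShattered {n k d : ℕ} {F : Finset (Finset (Fin n))} (hF : F.card ≤ k) :
    numShattered n d F ≤ maxShattered n k d :=
  Finset.le_sup (f := numShattered n d) (by simpa using hF)

/-- Averaging over all labelings: a `d`-set is shattered by a random `linearFamily` at least as
often as a random matrix over `𝔽₂` is invertible. -/
lemma partialConst_mul_choose_le_maxShattered {n k d : ℕ} (hk : 2 ^ d ≤ k) :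
    partialConst d * (n.choose d : ℝ) ≤ maxShattered n k d := by
  rcases lt_or_ge n d with hnd | hnd
  · simp [Nat.choose_eq_zero_of_lt hnd]
  have key := Finset.card_mul_le_card_mul
    (fun (A : Finset (Fin n)) (v : Fin n → Fin d → ZMod 2) => (linearFamily v).Shatters A)
    (s := Finset.univ.powersetCard d) (t := Finset.univ) (n := maxShattered n k d)
    (fun A hA => card_labelings_shattering_ge A (Finset.mem_powersetCard.1 hA).2)
    (fun v _ => numShattered_le_maxShattered ((card_linearFamily_le v).trans hk))
  simp only [Finset.card_powersetCard, Finset.card_univ, Fintype.card_fin, Fintype.card_pi,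
    ZMod.card, Finset.prod_const] at key
  have key' : (n.choose d : ℝ) * (partialConst d * (2 ^ d) ^ d * (2 ^ d) ^ (n - d)) ≤
      (2 ^ d) ^ n * maxShattered n k d := by
    rw [← card_isUnit_matrix]
    exact_mod_cast key
  rw [mul_assoc, ← pow_add, Nat.add_sub_cancel' hnd] at key'
  have hpos : (0 : ℝ) < (2 ^ d) ^ n := by positivity
  refine le_of_mul_le_mul_left ?_ hpos
  linarith

/-! ### Random tuples of columns of a `0`-`1` matrix -/

section Columns

variable {V K : Type*}

/-- The pattern of row `a` of the matrix `X` on the tuple of columns `v`. -/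
def pattern (X : V → K → Bool) {i : ℕ} (v : Fin i → V) (a : K) : Fin i → Bool :=
  fun l => X (v l) a

/-- The tuple `v` of columns is balanced with multiplicity `q`: each of the `2 ^ i` patterns occurs
in exactly `q` rows. -/
def BalancedColumns (X : V → K → Bool) {i : ℕ} (v : Fin i → V) (q : ℕ) : Prop :=
  ∀ p : Fin i → Bool, Nat.card {a : K // pattern X v a = p} = q

/-- The number of balanced `i`-tuples of columns, repetitions allowed. -/
noncomputable def balancedCount (X : V → K → Bool) (i q : ℕ) : ℕ :=
  Nat.card {v : Fin i → V // BalancedColumns X v q}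

/-- The number of columns on which the rows `a` and `b` agree. -/
noncomputable def agreeCount (X : V → K → Bool) (a b : K) : ℕ :=
  Nat.card {x : V // X x a = X x b}

/-- The sign of a bit. -/
def bitSign (b : Bool) : ℝ := if b then 1 else -1

open Classical in
lemma sum_bitSign_mul_bitSign [Fintype V] (X : V → K → Bool) (a b : K) :
    ∑ x, bitSign (X x a) * bitSign (X x b) = 2 * agreeCount X a b - Fintype.card V := by
  have h : ∀ x, bitSign (X x a) * bitSign (X x b) = 2 * (if X x a = X x b then 1 else 0) - 1 := by
    intro x
    cases X x a <;> cases X x b <;> norm_num [bitSign]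
  simp only [h, Finset.sum_sub_distrib, ← Finset.mul_sum, Finset.sum_boole, agreeCount,
    Nat.card_eq_fintype_card, Fintype.card_subtype]
  simp

lemma agreeCount_self [Fintype V] (X : V → K → Bool) (a : K) : agreeCount X a a = Fintype.card V := by
  simp [agreeCount]

open Classical in
lemma sum_pattern_eq [Fintype V] (X : V → K → Bool) (i : ℕ) (a b : K) :
    ∑ v : Fin i → V, (if pattern X v a = pattern X v b then (1 : ℝ) else 0)
      = (agreeCount X a b : ℝ) ^ i := by
  have h : (Finset.univ.filter fun v : Fin i → V => pattern X v a = pattern X v b)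
      = Fintype.piFinset fun _ => Finset.univ.filter fun x => X x a = X x b := by
    ext v
    simp [pattern, funext_iff]
  rw [Finset.sum_boole, h, Fintype.card_piFinset]
  simp [agreeCount, Nat.card_eq_fintype_card, Fintype.card_subtype]

open Classical in
lemma sum_sq_pattern_fibers [Fintype K] (X : V → K → Bool) {i : ℕ} (v : Fin i → V) (f : K → ℝ) :
    ∑ p, (∑ a with pattern X v a = p, f a) ^ 2
      = ∑ a, ∑ b, if pattern X v a = pattern X v b then f a * f b else 0 := by
  have h : ∀ p, (∑ a with pattern X v a = p, f a) ^ 2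
      = ∑ a with pattern X v a = p, ∑ b, if pattern X v a = pattern X v b then f a * f b else 0 := by
    intro p
    rw [sq, Finset.sum_mul]
    refine Finset.sum_congr rfl fun a ha => ?_
    rw [(Finset.mem_filter.1 ha).2, Finset.mul_sum, Finset.sum_filter]
    exact Finset.sum_congr rfl fun b _ => by simp only [eq_comm]
  rw [Finset.sum_congr rfl fun p _ => h p, Finset.sum_fiberwise]

lemma pattern_cons (X : V → K → Bool) {i : ℕ} (x : V) (v : Fin i → V) (a : K) :
    pattern X (Fin.cons x v : Fin (i + 1) → V) a = Fin.cons (X x a) (pattern X v a) := by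
  funext l
  refine Fin.cases ?_ (fun l => ?_) l <;> simp [pattern]

open Classical in
lemma BalancedColumns.card_of_cons [Fintype K] {X : V → K → Bool} {i q : ℕ} {x : V} {v : Fin i → V}
    (h : BalancedColumns X (Fin.cons x v : Fin (i + 1) → V) q) (p : Fin i → Bool) (β : Bool) :
    (Finset.univ.filter fun a => pattern X v a = p ∧ X x a = β).card = q := by
  rw [← h (Fin.cons β p), Nat.card_eq_fintype_card, Fintype.card_subtype]
  congr 1
  ext a
  simp [pattern_cons, Fin.cons_inj, and_comm]

open Classical in
lemma BalancedColumns.card_filter [Fintype K] {X : V → K → Bool} {i q : ℕ} {v : Fin i → V}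
    (h : BalancedColumns X v q) (p : Fin i → Bool) :
    (Finset.univ.filter fun a => pattern X v a = p).card = q := by
  rw [← h p, Nat.card_eq_fintype_card, Fintype.card_subtype]

lemma BalancedColumns.of_cons [Fintype K] {X : V → K → Bool} {i q : ℕ} {x : V} {v : Fin i → V}
    (h : BalancedColumns X (Fin.cons x v : Fin (i + 1) → V) q) : BalancedColumns X v (2 * q) := by
  classical
  intro p
  rw [Nat.card_eq_fintype_card, Fintype.card_subtype,
    ← Finset.card_filter_add_card_filter_not (fun a => X x a = true), Finset.filter_filter,
    Finset.filter_filter]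
  have h1 := h.card_of_cons p true
  have h2 := h.card_of_cons p false
  simp only [Bool.not_eq_true]
  lia

open Classical in
lemma BalancedColumns.sum_bitSign_eq_zero [Fintype K] {X : V → K → Bool} {i q : ℕ} {x : V} {v : Fin i → V}
    (h : BalancedColumns X (Fin.cons x v : Fin (i + 1) → V) q) (p : Fin i → Bool) :
    ∑ a with pattern X v a = p, bitSign (X x a) = 0 := by
  have h1 := h.card_of_cons p true
  have h2 := h.card_of_cons p false
  simp only [bitSign, Finset.sum_ite, Finset.sum_const, Finset.filter_filter, Bool.not_eq_true,
    h1, h2]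
  simp

open Classical in
/-- If `v` is balanced with multiplicity `Q`, the squared sums of the column `x` over the patterns
of `v` add up to at most `|K| Q`, and they all vanish when `x` extends `v` to a balanced tuple. -/
lemma indicator_balanced_cons_le [Fintype K] (X : V → K → Bool) {i q : ℕ} (x : V) (v : Fin i → V) :
    (Fintype.card K * (2 * q : ℝ)) *
        (if BalancedColumns X (Fin.cons x v : Fin (i + 1) → V) q then 1 else 0) ≤
      if BalancedColumns X v (2 * q) then Fintype.card K * (2 * q : ℝ) -
        ∑ a, ∑ b, (if pattern X v a = pattern X v b then
          bitSign (X x a) * bitSign (X x b) else 0) else 0 := by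
  rw [← sum_sq_pattern_fibers X v fun a => bitSign (X x a)]
  by_cases h : BalancedColumns X (Fin.cons x v : Fin (i + 1) → V) q
  · simp [h, h.of_cons, h.sum_bitSign_eq_zero]
  by_cases hv : BalancedColumns X v (2 * q)
  · simp only [h, if_false, mul_zero, hv, if_true, sub_nonneg]
    have hk : (Fintype.card K : ℝ) = ∑ _p : Fin i → Bool, (2 * q : ℝ) := by
      have h1 : Fintype.card K = ∑ p : Fin i → Bool,
          (Finset.univ.filter fun a => pattern X v a = p).card :=
        Finset.card_eq_sum_card_fiberwise fun _ _ => Finset.mem_coe.2 (Finset.mem_univ _)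
      rw [h1]
      simp [hv.card_filter]
    rw [hk, Finset.sum_mul]
    refine Finset.sum_le_sum fun p _ => ?_
    rw [← sq, sq_le_sq, abs_of_nonneg (by positivity : (0 : ℝ) ≤ 2 * q)]
    refine (Finset.abs_sum_le_sum_abs _ _).trans ?_
    have h1 : ∀ b, |bitSign b| = 1 := fun b => by cases b <;> norm_num [bitSign]
    have h2 := hv.card_filter p
    simp only [h1, Finset.sum_const, h2, nsmul_eq_mul, mul_one]
    simp
  · simp [h, hv]

open Classical in
lemma balancedCount_eq_sum [Fintype V] (X : V → K → Bool) (i q : ℕ) :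
    (balancedCount X i q : ℝ) = ∑ v : Fin i → V, if BalancedColumns X v q then 1 else 0 := by
  simp [balancedCount, Nat.card_eq_fintype_card, Fintype.card_subtype]

open Classical in
lemma balancedCount_succ_eq_sum [Fintype V] (X : V → K → Bool) (i q : ℕ) :
    (balancedCount X (i + 1) q : ℝ) =
      ∑ v : Fin i → V, ∑ x, if BalancedColumns X (Fin.cons x v : Fin (i + 1) → V) q then 1 else 0 := by
  rw [balancedCount_eq_sum, ← (Fin.consEquiv fun _ => V).sum_comp, Fintype.sum_prod_type,
    Finset.sum_comm]
  rfl

/-- Two rows that disagree on a positive excess of the columns rarely agree on `i` random ones: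
this is `y (1 - y) ^ i ≤ 1 / i`, where `y` is the excess as a proportion. -/
lemma excess_mul_pow_le {n S : ℝ} (hS : 0 ≤ S) (hn : 0 ≤ n) {i : ℕ} (hi : 0 < i) :
    max (n - 2 * S) 0 * S ^ i ≤ n ^ (i + 1) / (2 ^ i * i) := by
  rcases le_or_gt (n - 2 * S) 0 with h | h
  · rw [max_eq_right h, zero_mul]; positivity
  rw [max_eq_left h.le]
  have hn0 : 0 < n := by linarith
  have hi0 : (0 : ℝ) < i := by exact_mod_cast hi
  set y := (n - 2 * S) / n with hy
  have hy0 : 0 ≤ y := by positivity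
  have hy1 : y ≤ 1 := by rw [hy, div_le_one hn0]; linarith
  have hb : i * y * (1 - y) ^ i ≤ 1 :=
    calc i * y * (1 - y) ^ i ≤ (1 + y) ^ i * (1 - y) ^ i := by
          refine mul_le_mul_of_nonneg_right ?_ (pow_nonneg (by linarith) _)
          have := one_add_mul_le_pow (a := y) (by linarith) i
          linarith
      _ = (1 - y ^ 2) ^ i := by rw [← mul_pow]; ring
      _ ≤ 1 := pow_le_one₀ (by nlinarith) (by nlinarith)
  have h1 : n - 2 * S = n * y := by rw [hy]; field_simp
  have h2 : S = n * (1 - y) / 2 := by linarith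
  rw [h1, le_div_iff₀ (by positivity)]
  conv_lhs => rw [h2, div_pow, mul_pow]
  calc n * y * (n ^ i * (1 - y) ^ i / 2 ^ i) * (2 ^ i * i)
      = n ^ (i + 1) * (i * y * (1 - y) ^ i) := by field_simp; ring
    _ ≤ n ^ (i + 1) := mul_le_of_le_one_right (by positivity) hb

open Classical in
lemma sum_extensions_le [Fintype V] [Fintype K] (X : V → K → Bool) {i q : ℕ} (v : Fin i → V) :
    (Fintype.card K * (2 * q : ℝ)) *
        (∑ x, if BalancedColumns X (Fin.cons x v : Fin (i + 1) → V) q then 1 else 0) ≤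
      (Fintype.card K * (2 * q - 1) * Fintype.card V : ℝ) *
        (if BalancedColumns X v (2 * q) then 1 else 0) +
      ∑ a, ∑ b, max (Fintype.card V - 2 * agreeCount X a b : ℝ) 0 *
        (if pattern X v a = pattern X v b then 1 else 0) := by
  rw [Finset.mul_sum]
  refine (Finset.sum_le_sum fun x _ => indicator_balanced_cons_le X x v).trans ?_
  have hE : 0 ≤ ∑ a, ∑ b, max (Fintype.card V - 2 * agreeCount X a b : ℝ) 0 *
      (if pattern X v a = pattern X v b then 1 else 0) :=
    Finset.sum_nonneg fun a _ => Finset.sum_nonneg fun b _ =>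
      mul_nonneg (le_max_right _ _) (by split_ifs <;> norm_num)
  by_cases hv : BalancedColumns X v (2 * q)
  · simp only [hv, if_true, Finset.sum_sub_distrib, Finset.sum_const, Finset.card_univ,
      nsmul_eq_mul, mul_one]
    have hcomm : ∑ x, ∑ a, ∑ b, (if pattern X v a = pattern X v b then
        bitSign (X x a) * bitSign (X x b) else 0) =
        ∑ a, ∑ b, if pattern X v a = pattern X v b then
          (2 * agreeCount X a b - Fintype.card V : ℝ) else 0 := by
      rw [Finset.sum_comm]
      refine Finset.sum_congr rfl fun a _ => ?_
      rw [Finset.sum_comm]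
      refine Finset.sum_congr rfl fun b _ => ?_
      split_ifs
      · exact sum_bitSign_mul_bitSign X a b
      · simp
    -- The diagonal pairs contribute `|V|` each, the others at least minus their excess.
    have hlow : (Fintype.card K * Fintype.card V : ℝ) -
        ∑ a, ∑ b, max (Fintype.card V - 2 * agreeCount X a b : ℝ) 0 *
          (if pattern X v a = pattern X v b then 1 else 0) ≤
        ∑ a, ∑ b, if pattern X v a = pattern X v b then
          (2 * agreeCount X a b - Fintype.card V : ℝ) else 0 := by
      have hdiag : (Fintype.card K * Fintype.card V : ℝ) =
          ∑ a : K, ∑ b : K, if a = b then (Fintype.card V : ℝ) else 0 := by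
        simp
      rw [hdiag, ← Finset.sum_sub_distrib]
      refine Finset.sum_le_sum fun a _ => ?_
      rw [← Finset.sum_sub_distrib]
      refine Finset.sum_le_sum fun b _ => ?_
      by_cases hab : a = b
      · subst hab
        simp only [agreeCount_self, if_true]
        have : (Fintype.card V - 2 * Fintype.card V : ℝ) ≤ 0 := by
          have : (0 : ℝ) ≤ Fintype.card V := by positivity
          linarith
        rw [max_eq_right this]
        linarith
      · rw [if_neg hab]
        split_ifs
        · have := le_max_left (Fintype.card V - 2 * agreeCount X a b : ℝ) 0
          linarith
        · simp
    rw [hcomm]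
    linarith
  · simpa [hv] using hE

/-- One step of the upper bound: a random balanced `i`-tuple extends to a balanced
`(i + 1)`-tuple with probability at most `1 - 1 / (2 q)`, up to an error `1 / i`. -/
lemma balancedCount_succ_le [Fintype V] [Fintype K] (X : V → K → Bool) {i q : ℕ} (hi : 0 < i) (hq : 0 < q)
    (hK : Fintype.card K = 2 ^ i * (2 * q)) :
    (balancedCount X (i + 1) q : ℝ) ≤
      (1 - (2 * q : ℝ)⁻¹) * Fintype.card V * balancedCount X i (2 * q) +
        (Fintype.card V : ℝ) ^ (i + 1) / i := by
  classical
  set n : ℝ := (Fintype.card V : ℝ) with hn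
  set k : ℝ := (Fintype.card K : ℝ) with hk
  have hkq : k = 2 ^ i * (2 * q) := by rw [hk, hK]; push_cast; rfl
  have hq0 : (0 : ℝ) < q := by exact_mod_cast hq
  have hi0 : (0 : ℝ) < i := by exact_mod_cast hi
  have hk0 : 0 < k := by rw [hkq]; positivity
  have h1 := Finset.sum_le_sum fun (v : Fin i → V) (_ : v ∈ Finset.univ) =>
    sum_extensions_le X (q := q) v
  rw [← Finset.mul_sum, ← balancedCount_succ_eq_sum, Finset.sum_add_distrib, ← Finset.mul_sum,
    ← Nat.cast_ofNat, ← Nat.cast_mul, ← balancedCount_eq_sum] at h1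
  have h2 : ∑ v : Fin i → V, ∑ a, ∑ b, max (n - 2 * agreeCount X a b : ℝ) 0 *
      (if pattern X v a = pattern X v b then 1 else 0) ≤ k * (k * (n ^ (i + 1) / (2 ^ i * i))) := by
    rw [Finset.sum_comm]
    have : ∀ a : K, ∑ v : Fin i → V, ∑ b, max (n - 2 * agreeCount X a b : ℝ) 0 *
        (if pattern X v a = pattern X v b then 1 else 0) ≤ k * (n ^ (i + 1) / (2 ^ i * i)) := by
      intro a
      rw [Finset.sum_comm]
      have : ∀ b : K, ∑ v : Fin i → V, max (n - 2 * agreeCount X a b : ℝ) 0 *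
          (if pattern X v a = pattern X v b then 1 else 0) ≤ n ^ (i + 1) / (2 ^ i * i) := by
        intro b
        rw [← Finset.mul_sum, sum_pattern_eq]
        exact excess_mul_pow_le (Nat.cast_nonneg _) (Nat.cast_nonneg _) hi
      simpa using Finset.sum_le_sum fun b (_ : b ∈ Finset.univ) => this b
    simpa using Finset.sum_le_sum fun a (_ : a ∈ Finset.univ) => this a
  push_cast at h1
  rw [← hn, ← hk] at h1
  have h3 := h1.trans (add_le_add_right h2 _)
  have hpos : 0 < k * (2 * q : ℝ) := by positivity
  refine le_of_mul_le_mul_left (h3.trans_eq ?_) hpos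
  have h4 : k * (n ^ (i + 1) / (2 ^ i * i)) = 2 * q * (n ^ (i + 1) / i) := by
    rw [hkq]; field_simp
  rw [h4]
  field_simp

/-- In a matrix with `2 ^ (r + J)` rows, at most a proportion `∏_{j ≤ J} (1 - 2⁻ʲ) + J / r` of the
`(r + J)`-tuples of columns show every pattern. Only the last `J` columns are exploited. -/
lemma balancedCount_le [Fintype V] [Fintype K] (X : V → K → Bool) {r J : ℕ} (hr : 0 < r)
    (hK : Fintype.card K = 2 ^ (r + J)) :
    (balancedCount X (r + J) 1 : ℝ) ≤
      (partialConst J + J / r) * (Fintype.card V : ℝ) ^ (r + J) := by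
  have hr0 : (0 : ℝ) < r := by exact_mod_cast hr
  set n : ℝ := (Fintype.card V : ℝ) with hn
  have hn0 : 0 ≤ n := Nat.cast_nonneg _
  have key : ∀ t ≤ J, (balancedCount X (r + t) (2 ^ (J - t)) : ℝ) ≤
      (∏ s ∈ Finset.range t, (1 - (2 : ℝ)⁻¹ ^ (J - 1 - s + 1)) + t / r) * n ^ (r + t) := by
    intro t
    induction t with
    | zero =>
      intro _
      have : balancedCount X r (2 ^ J) ≤ Fintype.card V ^ r := by
        classical
        rw [balancedCount, Nat.card_eq_fintype_card]
        exact (Fintype.card_subtype_le _).trans (by simp)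
      simpa using (by rw [hn]; exact_mod_cast this : (balancedCount X r (2 ^ J) : ℝ) ≤ n ^ r)
    | succ t ih =>
      intro ht
      have h2 : 2 ^ (J - t) = 2 * 2 ^ (J - (t + 1)) := by
        rw [← pow_succ']; congr 1; lia
      have hexp : J - 1 - t + 1 = J - t := by lia
      have step := balancedCount_succ_le X (i := r + t) (q := 2 ^ (J - (t + 1))) (by lia)
        (by positivity) (by rw [hK, ← h2, ← pow_add]; congr 1; lia)
      rw [← h2] at step
      have hc : (2 * (2 ^ (J - (t + 1)) : ℕ) : ℝ)⁻¹ = 2⁻¹ ^ (J - t) := by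
        rw [inv_pow]; congr 1; exact_mod_cast h2.symm
      rw [hc] at step
      have hpos : 0 ≤ 1 - (2 : ℝ)⁻¹ ^ (J - t) := by
        have := one_sub_half_pow_pos (J - 1 - t); rw [hexp] at this; exact this.le
      have hle : 1 - (2 : ℝ)⁻¹ ^ (J - t) ≤ 1 := sub_le_self _ (by positivity)
      rw [Finset.prod_range_succ, hexp]
      set P := ∏ s ∈ Finset.range t, (1 - (2 : ℝ)⁻¹ ^ (J - 1 - s + 1))
      set c := 1 - (2 : ℝ)⁻¹ ^ (J - t)
      have hdiv : n ^ (r + t + 1) / ((r + t : ℕ) : ℝ) ≤ n ^ (r + t + 1) / r :=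
        div_le_div_of_nonneg_left (by positivity) hr0 (by exact_mod_cast Nat.le_add_right r t)
      have hct : c * (t / r : ℝ) ≤ t / r := mul_le_of_le_one_left (by positivity) hle
      calc (balancedCount X (r + t + 1) (2 ^ (J - (t + 1))) : ℝ)
          ≤ c * n * ((P + t / r) * n ^ (r + t)) + n ^ (r + t + 1) / r := by
            refine step.trans (add_le_add ?_ hdiv)
            exact mul_le_mul_of_nonneg_left (ih (by lia)) (mul_nonneg hpos hn0)
        _ = (P * c + c * (t / r) + 1 / r) * n ^ (r + t + 1) := by ring
        _ ≤ (P * c + t / r + 1 / r) * n ^ (r + t + 1) := by gcongr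
        _ = _ := by push_cast; ring
  have := key J le_rfl
  rw [Finset.prod_range_reflect (fun j => 1 - (2 : ℝ)⁻¹ ^ (j + 1)) J, Nat.sub_self, pow_zero] at this
  exact this

end Columns

/-! ### Upper bound for the number of shattered sets -/

/-- When `2 ^ D` sets shatter a `D`-set, each of its `D!` orderings is a balanced tuple of columns
of the incidence matrix. -/
lemma card_shattered_mul_factorial_le {α : Type*} [DecidableEq α] {D : ℕ} (W : Finset α)
    (G : Finset (Finset α)) (hG : G.card = 2 ^ D) :
    ((W.powersetCard D).filter fun A => G.Shatters A).card * D.factorial ≤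
      balancedCount (fun (x : W) (F : G) => decide ((x : α) ∈ (F : Finset α))) D 1 := by
  classical
  set X : W → G → Bool := fun x F => decide ((x : α) ∈ (F : Finset α)) with hX
  rw [balancedCount, Nat.card_eq_fintype_card, Fintype.card_subtype]
  have key := Finset.card_mul_le_card_mul
    (fun (A : Finset α) (v : Fin D → W) => Finset.univ.image (fun l => (v l : α)) = A)
    (s := (W.powersetCard D).filter fun A => G.Shatters A)
    (t := Finset.univ.filter fun v : Fin D → W => BalancedColumns X v 1)
    (m := D.factorial) (n := 1) (fun A hA => ?_) (fun v _ => ?_)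
  · simpa using key
  · obtain ⟨hA, hsh⟩ := Finset.mem_filter.1 hA
    obtain ⟨hAW, hcard⟩ := Finset.mem_powersetCard.1 hA
    have he : Fintype.card (Fin D ≃ A) = D.factorial := by
      rw [Fintype.card_equiv (A.equivFinOfCardEq hcard).symm, Fintype.card_fin]
    rw [← he, ← Finset.card_univ]
    refine Finset.card_le_card_of_injOn (fun e l => ⟨e l, hAW (e l).2⟩) (fun e _ => ?_) ?_
    · rw [Finset.mem_coe, Finset.mem_bipartiteAbove, Finset.mem_filter]
      refine ⟨⟨Finset.mem_univ _, ?_⟩, ?_⟩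
      · have hsurj : Function.Surjective
            (pattern X (fun l => (⟨e l, hAW (e l).2⟩ : W))) := by
          intro p
          obtain ⟨F, hF, hFt⟩ := hsh
            (t := Finset.univ.image fun l : {l // p l = true} => (e l : α))
            (fun x hx => by
              obtain ⟨l, -, rfl⟩ := Finset.mem_image.1 hx
              exact (e l).2)
          refine ⟨⟨F, hF⟩, funext fun l => ?_⟩
          have h1 : (e l : α) ∈ F ↔ p l = true := by
            have h2 : (e l : α) ∈ A ∩ F ↔ p l = true := by
              rw [hFt]
              simp
            simpa using h2
          exact Bool.eq_iff_iff.2 (decide_eq_true_iff.trans h1)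
        have hbij := (Fintype.bijective_iff_surjective_and_card _).2
          ⟨hsurj, by simp [hG]⟩
        intro p
        obtain ⟨F, hF, huniq⟩ := hbij.existsUnique p
        rw [Nat.card_eq_one_iff_unique]
        exact ⟨⟨fun a b => Subtype.ext ((huniq a a.2).trans (huniq b b.2).symm)⟩, ⟨⟨F, hF⟩⟩⟩
      · ext x
        simp only [Finset.mem_image, Finset.mem_univ, true_and]
        exact ⟨fun ⟨l, hl⟩ => hl ▸ (e l).2, fun hx => ⟨e.symm ⟨x, hx⟩, by simp⟩⟩
    · intro e _ e' _ h
      ext l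
      exact congrArg (fun w : W => (w : α)) (congrFun h l)
  · refine Finset.card_le_one.2 fun A hA B hB => ?_
    rw [Finset.mem_bipartiteBelow] at hA hB
    exact hA.2.symm.trans hB.2

lemma Finset.Shatters.two_pow_card_le {α : Type*} [DecidableEq α] {G : Finset (Finset α)}
    {A : Finset α} (h : G.Shatters A) : 2 ^ A.card ≤ G.card := by
  rw [← Finset.card_powerset, ← Finset.shatters_iff.1 h]
  exact Finset.card_image_le

/-- The number of shattered sets of fixed size `r + J`, when the family is as small as possible. -/
lemma card_shattered_le {α : Type*} [DecidableEq α] {r J : ℕ} (hr : 0 < r) (W : Finset α)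
    (G : Finset (Finset α)) (hG : G.card ≤ 2 ^ (r + J)) :
    (((W.powersetCard (r + J)).filter fun A => G.Shatters A).card : ℝ) ≤
      (partialConst J + J / r) * ((W.card : ℝ) ^ (r + J) / (r + J).factorial) := by
  have hp := partialConst_pos J
  rcases hG.lt_or_eq with hlt | heq
  · rw [Finset.filter_eq_empty_iff.2 fun A hA hsh => ?_]
    · simp only [Finset.card_empty, Nat.cast_zero]
      positivity
    · have := hsh.two_pow_card_le
      rw [(Finset.mem_powersetCard.1 hA).2] at this
      exact absurd hlt this.not_gt
  · rw [← mul_div_assoc, le_div_iff₀ (by positivity)]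
    have h1 := card_shattered_mul_factorial_le (D := r + J) W G heq
    have h2 := balancedCount_le (fun (x : W) (F : G) => decide ((x : α) ∈ (F : Finset α)))
      (r := r) (J := J) hr (by simpa using heq)
    rw [Fintype.card_coe] at h2
    exact le_trans (by exact_mod_cast h1) h2

/-- A family of fewer than `2 ^ |B| * (2 ^ D + 1)` sets has a trace on `B` shared by at most `2 ^ D`
members, and these members shatter `A \ B` whenever the family shatters `A ⊇ B`. -/
lemma exists_trace_class {α : Type*} [DecidableEq α] {D : ℕ} (F : Finset (Finset α)) (B : Finset α)
    (hF : F.card < 2 ^ B.card * (2 ^ D + 1)) :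
    ∃ G : Finset (Finset α), G.card ≤ 2 ^ D ∧
      ∀ A, B ⊆ A → F.Shatters A → G.Shatters (A \ B) := by
  obtain ⟨t, ht, hcard⟩ := Finset.exists_card_fiber_lt_of_card_lt_mul (s := F) (t := B.powerset)
    (f := fun S => S ∩ B) (n := 2 ^ D + 1) (by rwa [Finset.card_powerset])
  have htB := Finset.mem_powerset.1 ht
  refine ⟨_, Nat.lt_succ_iff.1 hcard, fun A hBA hsh C hC => ?_⟩
  have hCA : C ⊆ A := hC.trans Finset.sdiff_subset
  obtain ⟨S, hS, hSA⟩ := hsh (Finset.union_subset hCA (htB.trans hBA))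
  have hmem : ∀ x, x ∈ A ∧ x ∈ S ↔ x ∈ C ∨ x ∈ t := fun x => by
    rw [← Finset.mem_inter, hSA, Finset.mem_union]
  refine ⟨S, Finset.mem_filter.2 ⟨hS, ?_⟩, ?_⟩
  · ext x
    have h1 := hmem x
    have h2 := @hBA x
    have h3 := @hC x
    have h4 := @htB x
    simp only [Finset.mem_inter, Finset.mem_sdiff] at *
    tauto
  · ext x
    have h1 := hmem x
    have h3 := @hC x
    have h4 := @htB x
    simp only [Finset.mem_inter, Finset.mem_sdiff] at *
    tauto

/-- Double counting of pairs `B ⊆ A` with `A` shattered and `|A \ B| = D`. -/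
lemma numShattered_mul_choose_le {n d D M : ℕ} (hD : D ≤ d)
    (F : Finset (Finset (Fin n))) (hF : F.card < 2 ^ d + 2 ^ (d - D))
    (hM : ∀ (W : Finset (Fin n)) (G : Finset (Finset (Fin n))), W.card = n - (d - D) →
      G.card ≤ 2 ^ D → ((W.powersetCard D).filter fun A => G.Shatters A).card ≤ M) :
    numShattered n d F * d.choose (d - D) ≤ n.choose (d - D) * M := by
  classical
  have key := Finset.card_mul_le_card_mul (fun A B : Finset (Fin n) => B ⊆ A)
    (s := (Finset.univ.powersetCard d).filter fun A => F.Shatters A)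
    (t := Finset.univ.powersetCard (d - D)) (m := d.choose (d - D)) (n := M)
    (fun A hA => ?_) (fun B hB => ?_)
  · simpa [numShattered] using key
  · have hcard := (Finset.mem_powersetCard.1 (Finset.mem_filter.1 hA).1).2
    rw [← hcard, ← Finset.card_powersetCard, hcard]
    refine Finset.card_le_card fun B hB => ?_
    rw [Finset.mem_powersetCard] at hB
    rw [Finset.mem_bipartiteAbove, Finset.mem_powersetCard]
    exact ⟨⟨Finset.subset_univ _, hB.2⟩, hB.1⟩
  · have hBc := (Finset.mem_powersetCard.1 hB).2
    obtain ⟨G, hG, hsh⟩ := exists_trace_class (D := D) F B (by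
      rw [hBc, mul_add, ← pow_add, Nat.sub_add_cancel hD, mul_one]
      exact hF)
    refine le_trans ?_ (hM Bᶜ G (by rw [Finset.card_compl, hBc, Fintype.card_fin]) hG)
    refine Finset.card_le_card_of_injOn (fun A => A \ B) (fun A hA => ?_) ?_
    · obtain ⟨hA, hBA⟩ := (Finset.mem_bipartiteBelow _).1 (Finset.mem_coe.1 hA)
      obtain ⟨hA, hFA⟩ := Finset.mem_filter.1 hA
      rw [Finset.mem_coe, Finset.mem_filter, Finset.mem_powersetCard]
      refine ⟨⟨?_, ?_⟩, hsh A hBA hFA⟩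
      · exact fun x hx => Finset.mem_compl.2 (Finset.mem_sdiff.1 hx).2
      · rw [Finset.card_sdiff_of_subset hBA, hBc, (Finset.mem_powersetCard.1 hA).2]
        lia
    · intro A hA A' hA' h
      rw [← Finset.sdiff_union_of_subset ((Finset.mem_bipartiteBelow _).1 (Finset.mem_coe.1 hA)).2,
        ← Finset.sdiff_union_of_subset ((Finset.mem_bipartiteBelow _).1 (Finset.mem_coe.1 hA')).2]
      exact congrArg (· ∪ B) h

lemma maxShattered_le {n k d r J : ℕ} (hr : 0 < r) (hD : r + J ≤ d) (hd : d ≤ n)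
    (hk : k < 2 ^ d + 2 ^ (d - (r + J))) :
    (maxShattered n k d : ℝ) ≤ (partialConst J + J / r) *
      ((((n - (d - (r + J)) : ℕ) : ℝ) ^ (r + J) / (r + J).factorial) /
        ((n - (d - (r + J))).choose (r + J) : ℝ)) * (n.choose d : ℝ) := by
  obtain ⟨F, hF, hmax⟩ := Finset.exists_mem_eq_sup
    ((Finset.univ : Finset (Finset (Finset (Fin n)))).filter fun F => F.card ≤ k)
    ⟨∅, by simp⟩ (numShattered n d)
  have hF := (Finset.mem_filter.1 hF).2
  rw [maxShattered, hmax]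
  set D := r + J with hDdef
  set m := n - (d - D) with hm
  set R : ℝ := (partialConst J + J / r) * ((m : ℝ) ^ D / D.factorial) with hR
  have hR0 : 0 ≤ R := by have := partialConst_pos J; positivity
  have h1 := numShattered_mul_choose_le (M := ⌊R⌋₊) hD F (hF.trans_lt hk) fun W G hW hG => by
    refine Nat.le_floor ?_
    rw [hR, hm, ← hW]
    exact card_shattered_le hr W G hG
  have h2 : (numShattered n d F : ℝ) * d.choose (d - D) ≤ n.choose (d - D) * R :=
    le_trans (by exact_mod_cast h1)
      (mul_le_mul_of_nonneg_left (Nat.floor_le hR0) (Nat.cast_nonneg _))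
  have h3 : (n.choose d : ℝ) * d.choose (d - D) = n.choose (d - D) * m.choose D := by
    have := Nat.choose_mul (n := n) (k := d) (s := d - D) (Nat.sub_le d D)
    rw [Nat.sub_sub_self hD] at this
    exact_mod_cast this
  have hpos : (0 : ℝ) < d.choose (d - D) := by exact_mod_cast Nat.choose_pos (Nat.sub_le d D)
  have hpos' : (0 : ℝ) < m.choose D := by exact_mod_cast Nat.choose_pos (by lia)
  refine le_of_mul_le_mul_right (h2.trans_eq ?_) hpos
  rw [mul_assoc, h3, hR]
  field_simp

/-! ### The asymptotic formula -/

lemma tendsto_pow_div_factorial_div_choose (D : ℕ) :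
    Tendsto (fun m : ℕ => ((m : ℝ) ^ D / D.factorial) / (m.choose D : ℝ)) atTop (𝓝 1) := by
  have hne : ∀ᶠ m : ℕ in atTop, (m.choose D : ℝ) ≠ 0 :=
    (eventually_ge_atTop D).mono fun m hm => by exact_mod_cast (Nat.choose_pos hm).ne'
  exact (isEquivalent_iff_tendsto_one hne).1 (isEquivalent_choose D).symm

lemma maxShattered_isEquivalent {ι : Type*} (l : Filter ι) (n d k : ι → ℕ)
    (hd : Tendsto d l atTop) (hnd : Tendsto (fun i => (n i : ℤ) - (d i : ℤ)) l atTop)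
    (hk : ∀ᶠ i in l, 2 ^ d i ≤ k i)
    (hk1 : Tendsto (fun i => (k i : ℝ) / 2 ^ d i) l (𝓝 1)) :
    (fun i => (maxShattered (n i) (k i) (d i) : ℝ)) ~[l]
      (fun i => limitConst * ((n i).choose (d i) : ℝ)) := by
  have hle : ∀ᶠ i in l, d i ≤ n i :=
    (hnd.eventually_ge_atTop 0).mono fun i hi => by lia
  have hlim : Tendsto (fun i => (maxShattered (n i) (k i) (d i) : ℝ) / (n i).choose (d i)) l
      (𝓝 limitConst) := by
    refine tendsto_order.2 ⟨fun a ha => ?_, fun b hb => ?_⟩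
    · filter_upwards [hk, hle, (tendsto_partialConst.comp hd).eventually_const_lt ha]
        with i hki hi hai
      have hpos : (0 : ℝ) < (n i).choose (d i) := by exact_mod_cast Nat.choose_pos hi
      exact hai.trans_le ((le_div_iff₀ hpos).2 (partialConst_mul_choose_le_maxShattered hki))
    · obtain ⟨J, hJ⟩ := (tendsto_partialConst.eventually_lt_const hb).exists
      have hr : Tendsto (fun r : ℕ => partialConst J + (J : ℝ) / r) atTop
          (𝓝 (partialConst J)) := by
        simpa using (tendsto_const_div_atTop_nhds_zero_nat (J : ℝ)).const_add (partialConst J)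
      obtain ⟨r, hrb, hr0⟩ := ((hr.eventually_lt_const hJ).and (eventually_gt_atTop 0)).exists
      have hm : Tendsto (fun i => n i - (d i - (r + J))) l atTop :=
        tendsto_atTop.2 fun N => (hnd.eventually_ge_atTop (N : ℤ)).mono fun i hi => by lia
      have hup := (((tendsto_pow_div_factorial_div_choose (r + J)).comp hm).const_mul
        (partialConst J + (J : ℝ) / r)).eventually_lt_const (by rwa [mul_one])
      have hk2 : ∀ᶠ i in l, (k i : ℝ) / 2 ^ d i < 1 + 2⁻¹ ^ (r + J) :=
        hk1.eventually_lt_const (lt_add_of_pos_right 1 (by positivity))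
      filter_upwards [hle, hd.eventually_ge_atTop (r + J), hup, hk2] with i hi hdi hub hki
      have hpos : (0 : ℝ) < (n i).choose (d i) := by exact_mod_cast Nat.choose_pos hi
      refine lt_of_le_of_lt ((div_le_iff₀ hpos).2 (maxShattered_le hr0 hdi hi ?_)) hub
      rw [div_lt_iff₀ (by positivity), add_mul, one_mul] at hki
      have hpow : (2 : ℝ)⁻¹ ^ (r + J) * 2 ^ d i = 2 ^ (d i - (r + J)) := by
        conv_lhs => rw [← Nat.sub_add_cancel hdi, pow_add 2 (d i - (r + J)), mul_left_comm, ← mul_pow]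
        norm_num
      rw [hpow] at hki
      exact_mod_cast hki
  refine isEquivalent_of_tendsto_one ?_
  have h := hlim.div_const limitConst
  rw [div_self limitConst_pos.ne'] at h
  refine h.congr fun i => ?_
  rw [Pi.div_apply, div_div, mul_comm limitConst]

theorem theorem1p3 :
    -- the constant `c`: the product converges, and is the limit of the stated probabilities
    (Multipliable (fun i : ℕ => 1 - (2 : ℝ)⁻¹ ^ (i + 1)) ∧
      Tendsto shatterConst atTop (𝓝 limitConst) ∧
      Tendsto invertibleProb atTop (𝓝 limitConst) ∧
      |limitConst - 0.289| < 0.0005) ∧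
    -- the asymptotic formula, along any filter on any index type
    (∀ {ι : Type*} (l : Filter ι) (n d : ι → ℕ),
      Tendsto d l atTop →
      Tendsto (fun i => (n i : ℤ) - (d i : ℤ)) l atTop →
      (∀ k : ι → ℕ,
        (∀ᶠ i in l, 2 ^ d i ≤ k i) →
        Tendsto (fun i => (k i : ℝ) / 2 ^ d i) l (𝓝 1) →
        (fun i => (maxShattered (n i) (k i) (d i) : ℝ)) ~[l]
          (fun i => limitConst * ((n i).choose (d i) : ℝ))) ∧
      (fun i => (maxShattered (n i) (2 ^ d i) (d i) : ℝ)) ~[l]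
        (fun i => limitConst * ((n i).choose (d i) : ℝ))) := by
  refine ⟨⟨multipliable_one_sub_half_pow, tendsto_shatterConst, tendsto_invertibleProb,
    abs_limitConst_sub_lt⟩, fun l n d hd hnd => ⟨fun k hk hk1 =>
      maxShattered_isEquivalent l n d k hd hnd hk hk1,
      maxShattered_isEquivalent l n d _ hd hnd (Eventually.of_forall fun _ => le_rfl) ?_⟩⟩
  have h : ∀ i, (((2 ^ d i : ℕ) : ℝ)) / 2 ^ d i = 1 := fun i => by
    rw [Nat.cast_pow, Nat.cast_ofNat, div_self (by positivity)]
  simp only [h]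
  exact tendsto_const_nhds
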